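/- Let $\mathbb F$ be a field of characteristic $0$. A vertex algebra (in the super sense) is a vector superspace $V=V_{\bar 0}\oplus V_{\bar 1}$ over $\mathbb F$ with a bilinear product $a\otimes b\mapsto a(z)b=\sum_{n\in\mathbb Z}(a_{(n)}b)z^{-n-1}\in V((z))$ such that $a_{(n)}b\in V_{\alpha+\beta}$ for $a\in V_\alpha$, $b\in V_\beta$, an even linear map $T\colon V\to V$ with $T(a(z)b)=(Ta)(z)b+a(z)Tb$ and $(Ta)(z)=\partial_z a(z)$, and a non-zero vector $1\in V$ with $1(z)a=a$ and $a(z)1\in a+zV[[z]]$ for all $a\in V$, such that for all $a\in V_\alpha$, $b\in V_\beta$ there is an integer $N\ge 0$ with $(z-w)^N\big(a(z)b(w)-(-1)^{\alpha\beta}b(w)a(z)\big)=0$; here $a(z)=\sum_n a_{(n)}z^{-n-1}\in(\operatorname{End}V)[[z,z^{-1}]]$. (If $V_{\bar 1}=0$, this is an ordinary vertex algebra.) Put $$\delta(z,w)=\sum_{m\in\mathbb Z}z^{-m-1}w^m,\qquad i_{z,w}(z-w)^n=\sum_{k\ge 0}\binom nk z^{n-k}(-w)^k,\qquad i_{w,z}(z-w)^n=\sum_{k\ge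 0}\binom nk z^k(-w)^{n-k}.$$ **Proposition (Borcherds identity).** Let $V$ be a vertex algebra, let $a,b\in V$ be homogeneous of parities $p(a),p(b)$, and let $n\in\mathbb Z$. Then $$a(z)b(w)\,i_{z,w}(z-w)^n-(-1)^{p(a)p(b)}\,b(w)a(z)\,i_{w,z}(z-w)^n=\sum_{j\ge 0}(a_{(n+j)}b)(w)\,\frac{\partial_w^j\delta(z,w)}{j!}$$ as elements of $(\operatorname{End}V)[[z,z^{-1},w,w^{-1}]]$. Here all the products are well defined (applied to any vector of $V$, each coefficient is a finite sum), and $a_{(n+j)}b=0$ for all but finitely many $j\ge 0$. -/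

import Mathlib

noncomputable section

/-! ### Formal distributions -/

/-- `U[[z, z⁻¹]]`: the bilateral series `∑ a_m z^m`, with `a m` the coefficient of `z ^ m`. -/
abbrev FormalDist (U : Type*) := ℤ → U

/-- `U[[z, z⁻¹, w, w⁻¹]]`, with `A p q` the coefficient of `z ^ p * w ^ q`. -/
abbrev FormalDist₂ (U : Type*) := ℤ → ℤ → U

namespace FormalDist

variable {U : Type*} [AddCommGroup U]

/-- The derivative `∂_z a(z)`. -/
def deriv (a : FormalDist U) : FormalDist U :=
  fun m => (m + 1) • a (m + 1)

/-- The distribution `a(w)`, viewed as a distribution in the two variables `z` and `w`. -/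
def inW (a : FormalDist U) : FormalDist₂ U :=
  fun p q => if p = 0 then a q else 0

end FormalDist

namespace FormalDist₂

section AddCommGroup

variable {U : Type*} [AddCommGroup U]

/-- Multiplication by the polynomial `z - w`. -/
def mulZSubW (A : FormalDist₂ U) : FormalDist₂ U :=
  fun p q => A (p - 1) q - A p (q - 1)

/-- The derivative `∂_w A(z, w)`. -/
def derivW (A : FormalDist₂ U) : FormalDist₂ U :=
  fun p q => (q + 1) • A p (q + 1)

end AddCommGroup

section Ring

variable {R : Type*} [Ring R]

/-- The product `a(z) b(w)`. -/
def prodZW (a b : FormalDist R) : FormalDist₂ R :=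
  fun p q => a p * b q

/-- The product `b(w) a(z)`. -/
def prodWZ (b a : FormalDist R) : FormalDist₂ R :=
  fun p q => b q * a p

end Ring

section Scalar

variable (F : Type*) [Field F]

/-- The formal delta function `δ(z, w) = ∑_{n ∈ ℤ} z^(-n-1) w^n`. -/
def delta : FormalDist₂ F :=
  fun p q => if p = -q - 1 then 1 else 0

/-- `∂_w^j δ(z, w) / j!`. -/
def deltaDeriv (j : ℕ) : FormalDist₂ F :=
  (j.factorial : F)⁻¹ • derivW^[j] (delta F)

/-- `i_{z,w} (z - w)^n = ∑_{k ≥ 0} (n choose k) z^(n-k) (-w)^k`: the expansion of `(z - w)^n`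
in the domain `|z| > |w|`. -/
def expandZW (n : ℤ) : FormalDist₂ F :=
  fun p q => if p + q = n ∧ 0 ≤ q then (-1) ^ q * ((Ring.choose n q.toNat : ℤ) : F) else 0

/-- `i_{w,z} (z - w)^n = ∑_{k ≥ 0} (n choose k) z^k (-w)^(n-k)`: the expansion of `(z - w)^n`
in the domain `|z| < |w|`. -/
def expandWZ (n : ℤ) : FormalDist₂ F :=
  fun p q => if p + q = n ∧ 0 ≤ p then (-1) ^ q * ((Ring.choose n p.toNat : ℤ) : F) else 0

end Scalar

end FormalDist₂

/-! ### Infinite sums and products of operator-valued distributions -/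

section LocallyFinite

variable {F V : Type*} [Field F] [AddCommGroup V] [Module F V]

/-- A family of operators is locally finite if every vector is killed by all but finitely many
of them; this is what makes the sum of the family a well-defined operator. -/
def LocallyFiniteFamily {ι : Type*} (f : ι → Module.End F V) : Prop :=
  ∀ v : V, (Function.support fun i => f i v).Finite

open Classical in
/-- The sum of a locally finite family of operators (and `0` for other families). -/
def locallyFiniteSum {ι : Type*} (f : ι → Module.End F V) : Module.End F V :=
  if h : LocallyFiniteFamily f then
    { toFun := fun v => ∑ᶠ i, f i v
      map_add' := fun u v => by
        simp only [map_add]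
        exact finsum_add_distrib (h u) (h v)
      map_smul' := fun c v => by
        simp only [map_smul, RingHom.id_apply]
        exact (smul_finsum c fun i => f i v).symm }
  else 0

namespace FormalDist₂

/-- The product of the scalar distribution `c(z, w)` and the operator-valued distribution
`A(z, w)` is well defined: for each `p`, `q` the family of all the contributions to the
coefficient of `z ^ p * w ^ q` is locally finite. -/
def MulDefined (c : FormalDist₂ F) (A : FormalDist₂ (Module.End F V)) : Prop :=
  ∀ p q : ℤ, LocallyFiniteFamily fun e : ℤ × ℤ => c e.1 e.2 • A (p - e.1) (q - e.2)

/-- The product `c(z, w) A(z, w)`, meaningful if `MulDefined c A`. -/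
def mul (c : FormalDist₂ F) (A : FormalDist₂ (Module.End F V)) :
    FormalDist₂ (Module.End F V) :=
  fun p q => locallyFiniteSum fun e : ℤ × ℤ => c e.1 e.2 • A (p - e.1) (q - e.2)

end FormalDist₂

end LocallyFinite

/-! ### Vertex algebras -/

/-- The sign `(-1)^(αβ)` attached to two parities. -/
def koszulSign (α β : ZMod 2) : ℤ := (-1) ^ (α.val * β.val)

/-- A `z`-algebra (in the super sense): a superspace `V = V₀ ⊕ V₁` with an even bilinear product
`a(z)b` with values in `V((z))` and an even derivation `T` of it with `(Ta)(z) = ∂_z a(z)`. -/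
structure ZAlgebra (F V : Type*) [Field F] [AddCommGroup V] [Module F V] where
  /-- The subspace of the elements of a given parity. -/
  parity : ZMod 2 → Submodule F V
  isInternal : DirectSum.IsInternal parity
  /-- The product: `Y a b` is the Laurent series `a(z)b`. -/
  Y : V →ₗ[F] VertexOperator F V
  /-- The derivation. -/
  T : Module.End F V
  Y_parity : ∀ (α β : ZMod 2) (a b : V), a ∈ parity α → b ∈ parity β →
    ∀ m : ℤ, HVertexOperator.coeff (Y a) m b ∈ parity (α + β)
  T_parity : ∀ (α : ZMod 2) (a : V), a ∈ parity α → T a ∈ parity α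
  T_derivation : ∀ (a b : V) (m : ℤ), T (HVertexOperator.coeff (Y a) m b) =
    HVertexOperator.coeff (Y (T a)) m b + HVertexOperator.coeff (Y a) m (T b)
  Y_T : ∀ a : V, HVertexOperator.coeff (Y (T a)) = FormalDist.deriv (HVertexOperator.coeff (Y a))

namespace ZAlgebra

variable {F V : Type*} [Field F] [AddCommGroup V] [Module F V] (A : ZAlgebra F V)

/-- The `End V`-valued distribution `a(z)`. -/
def field (a : V) : FormalDist (Module.End F V) := HVertexOperator.coeff (A.Y a)

/-- The `n`-th product `a_(n) b`, the coefficient of `z ^ (-n - 1)` in `a(z)b`. -/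
def nProd (a : V) (n : ℤ) (b : V) : V := VertexOperator.ncoeff (A.Y a) n b

/-- `e` is a unit element: `e ≠ 0`, `e(z)a = a`, and `a(z)e = a` modulo `z V[[z]]`. -/
def IsUnitElement (e : V) : Prop :=
  e ≠ 0 ∧
  (∀ (a : V) (m : ℤ), A.field e m a = if m = 0 then a else 0) ∧
  (∀ (a : V) (m : ℤ), m ≤ 0 → A.field a m e = if m = 0 then a else 0)

/-- Locality: `(z - w)^N (a(z) b(w) - (-1)^(p(a)p(b)) b(w) a(z)) = 0` for some `N`, for all `a`
and `b` of definite parity. -/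
def IsLocal : Prop :=
  ∀ (α β : ZMod 2) (a b : V), a ∈ A.parity α → b ∈ A.parity β →
    ∃ N : ℕ, FormalDist₂.mulZSubW^[N]
      (FormalDist₂.prodZW (A.field a) (A.field b) -
        koszulSign α β • FormalDist₂.prodWZ (A.field b) (A.field a)) = 0

end ZAlgebra

/-- A vertex (super)algebra: a local unital `z`-algebra. A purely even one has
`parity 1 = ⊥`. -/
structure VertexAlgebra (F V : Type*) [Field F] [AddCommGroup V] [Module F V] extends
    ZAlgebra F V where
  /-- The unit element (vacuum vector). -/
  one : V
  isUnitElement : toZAlgebra.IsUnitElement one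
  isLocal : toZAlgebra.IsLocal

end

/-! Write `X n` for either side of the identity. Pascal's rule gives `(z - w) X n = X (n + 1)` on
both sides. For large `n` both sides vanish: the left by locality, the right because `a(z)b` is a
Laurent series. Descending in `n`, the difference of the sides is killed by `z - w`, so its
coefficient at `z^p w^q` depends only on `p + q`, and it is zero as soon as its residue in `z` is.
Everything thus rests on the `n`-th product identity, that the residue of the left side is `(a_(n)
b)(w)` (`VertexAlgebra.borcherdsLHS_residue`).

That identity follows from Goddard's uniqueness argument. Both of its sides are local with every
field `x(w)`, `x` homogeneous: the residue by Dong's lemma, the other by the axiom. If they also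
agree on the vacuum, their difference kills the constant term `x` of `x(w)1`, hence everything. On
the vacuum, the constant terms in `w` agree by direct computation; the higher ones follow
recursively, because `∂_z + ∂_w` satisfies the Leibniz rule on the left side, the residue kills
`∂_z`, and `T` is a derivation of the products.

Statements about the infinite sums `a(z)b(w) i_{z,w}(z-w)^n` are mostly proved at `n = 0` and
carried to all `n` by `eq_zero_of_mulZSubW_eq_succ`: multiplication by `z - w` is injective on
distributions bounded below in `w`. -/

namespace FormalDist₂

/-! ### Distributions killed by `z - w` -/

section AddCommGroup

variable {U : Type*} [AddCommGroup U]

theorem mulZSubW_apply (A : FormalDist₂ U) (p q : ℤ) :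
    mulZSubW A p q = A (p - 1) q - A p (q - 1) := rfl

theorem mulZSubW_iterate_zero (N : ℕ) : mulZSubW^[N] (0 : FormalDist₂ U) = 0 := by
  apply Function.iterate_fixed
  funext p q
  simp [mulZSubW]

/-- A distribution killed by `z - w` with vanishing residue in `z` is zero. -/
theorem eq_zero_of_mulZSubW_eq_zero_of_residue {A : FormalDist₂ U} (hA : mulZSubW A = 0)
    (hres : ∀ q, A (-1) q = 0) : A = 0 := by
  -- Coefficients are constant on each line of fixed `p + q`, and every such line meets `p = -1`.
  have step : ∀ p q, A (p - 1) q = A p (q - 1) := fun p q =>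
    sub_eq_zero.1 (congrFun (congrFun hA p) q)
  have key : ∀ m : ℤ, ∀ q, A m q = 0 := by
    intro m
    induction m using Int.induction_on with
    | zero => intro q; simpa [hres] using (step 0 (q + 1)).symm
    | succ i ih => intro q; simpa [ih] using (step (i + 1) (q + 1)).symm
    | pred i ih => intro q; rw [step, ih]
  funext p q
  exact key p q

/-- A distribution killed by `z - w` whose powers of `w` are bounded below is zero. -/
theorem eq_zero_of_mulZSubW_eq_zero_of_bounded {A : FormalDist₂ U} (hA : mulZSubW A = 0)
    (hbd : ∃ q₀, ∀ p, ∀ q < q₀, A p q = 0) : A = 0 := by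
  obtain ⟨q₀, hq₀⟩ := hbd
  have step : ∀ p q, A (p - 1) q = A p (q - 1) := fun p q =>
    sub_eq_zero.1 (congrFun (congrFun hA p) q)
  have key : ∀ (k : ℕ) p q, q < q₀ + k → A p q = 0 := by
    intro k
    induction k with
    | zero => intro p q h; exact hq₀ p q (by simpa using h)
    | succ k ih =>
      intro p q h
      have := step (p + 1) q
      rw [add_sub_cancel_right] at this
      rw [this]
      exact ih _ _ (by push_cast at h; lia)
  funext p q
  exact key (q - q₀ + 1).toNat p q (by lia)

end AddCommGroup

/-! ### Products with the two expansions of `(z - w)^n` -/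

section Operators

variable {F V : Type*} [Field F] [AddCommGroup V] [Module F V]

theorem locallyFiniteSum_apply {ι : Type*} {f : ι → Module.End F V}
    (h : LocallyFiniteFamily f) (v : V) : locallyFiniteSum f v = ∑ᶠ i, f i v := by
  simp only [locallyFiniteSum, dif_pos h]
  rfl

/-- The operator-valued distribution `a(z)` is a field: `a(z)v` is a Laurent series for all `v`. -/
def _root_.FormalDist.LowerTruncated (a : FormalDist (Module.End F V)) : Prop :=
  ∀ v, ∃ m₀ : ℤ, ∀ m < m₀, a m v = 0

variable {a b : FormalDist (Module.End F V)}

theorem support_expandZW_smul_prodZW_subset (n p q : ℤ) (v : V) (K : ℕ)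
    (hK : ∀ k : ℕ, K ≤ k → b (q - k) v = 0) :
    (Function.support fun e : ℤ × ℤ =>
      (expandZW F n e.1 e.2 • prodZW a b (p - e.1) (q - e.2)) v) ⊆
      ((Finset.range K).image fun k : ℕ => (n - k, (k : ℤ)) : Finset (ℤ × ℤ)) := by
  rintro ⟨e₁, e₂⟩ he
  simp only [Function.mem_support, expandZW, prodZW] at he
  have h1 : e₁ + e₂ = n ∧ 0 ≤ e₂ := by
    by_contra h
    simp [h] at he
  obtain ⟨k, rfl⟩ := Int.eq_ofNat_of_zero_le h1.2
  simp only [Finset.coe_image, Set.mem_image, Finset.mem_coe, Finset.mem_range, Prod.mk.injEq]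
  refine ⟨k, ?_, by lia, rfl⟩
  by_contra h
  exact he (by simp [h1.1, hK k (by lia)])

theorem exists_forall_ge_apply_sub_eq_zero (hb : b.LowerTruncated) (q : ℤ) (v : V) :
    ∃ K : ℕ, ∀ k : ℕ, K ≤ k → b (q - k) v = 0 := by
  obtain ⟨m₀, hm₀⟩ := hb v
  exact ⟨(q - m₀ + 1).toNat, fun k hk => hm₀ _ (by lia)⟩

theorem mulDefined_expandZW (hb : b.LowerTruncated) (n : ℤ) :
    MulDefined (expandZW F n) (prodZW a b) := by
  intro p q v
  obtain ⟨K, hK⟩ := exists_forall_ge_apply_sub_eq_zero hb q v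
  exact (Finset.finite_toSet _).subset (support_expandZW_smul_prodZW_subset n p q v K hK)

/-- Any sufficiently large `K` is allowed, so that sums for neighbouring coefficients can be given
matching ranges. -/
theorem mul_expandZW_apply (hb : b.LowerTruncated) (n p q : ℤ) (v : V) (K : ℕ)
    (hK : ∀ k : ℕ, K ≤ k → b (q - k) v = 0) :
    mul (expandZW F n) (prodZW a b) p q v =
      ∑ k ∈ Finset.range K, ((-1) ^ k * Ring.choose n k : ℤ) • a (p - n + k) (b (q - k) v) := by
  rw [mul, locallyFiniteSum_apply (mulDefined_expandZW hb n p q),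
    finsum_eq_sum_of_support_subset _ (support_expandZW_smul_prodZW_subset n p q v K hK),
    Finset.sum_image (by intro x _ y _ h; simpa using h)]
  refine Finset.sum_congr rfl fun k _ => ?_
  simp only [expandZW, prodZW, sub_add_cancel, Nat.cast_nonneg, and_self, if_true,
    Int.toNat_natCast, zpow_natCast, LinearMap.smul_apply, Module.End.mul_apply]
  rw [← Int.cast_smul_eq_zsmul F, sub_sub_eq_add_sub, add_sub_right_comm]
  push_cast
  rfl

/-- Pascal's rule, after shifting the summation index in the terms coming from `z`. -/
theorem mulZSubW_mul_expandZW (hb : b.LowerTruncated) (n : ℤ) :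
    mulZSubW (mul (expandZW F n) (prodZW a b)) = mul (expandZW F (n + 1)) (prodZW a b) := by
  funext p q
  ext v
  obtain ⟨K, hK⟩ := exists_forall_ge_apply_sub_eq_zero hb (q - 1) v
  have hK' : ∀ k : ℕ, K + 1 ≤ k → b (q - k) v = 0 := by
    intro k hk
    have := hK (k - 1) (by lia)
    rwa [Nat.cast_sub (by lia), Nat.cast_one, sub_sub_sub_cancel_right] at this
  rw [mulZSubW_apply, LinearMap.sub_apply, mul_expandZW_apply hb n _ _ v (K + 1) hK',
    mul_expandZW_apply hb n _ _ v K hK, mul_expandZW_apply hb (n + 1) _ _ v (K + 1) hK',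
    Finset.sum_range_succ', Finset.sum_range_succ', add_sub_right_comm, ← Finset.sum_sub_distrib]
  congr 1
  · refine Finset.sum_congr rfl fun k _ => ?_
    rw [show p - 1 - n + ((k + 1 : ℕ) : ℤ) = p - n + k by push_cast; ring,
      show p - (n + 1) + ((k + 1 : ℕ) : ℤ) = p - n + k by push_cast; ring,
      show q - ((k + 1 : ℕ) : ℤ) = q - 1 - k by push_cast; ring, ← sub_smul,
      Ring.choose_succ_succ]
    congr 1
    ring
  · simp [sub_sub, add_comm]

theorem mul_expandZW_zero (hb : b.LowerTruncated) :
    mul (expandZW F 0) (prodZW a b) = prodZW a b := by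
  funext p q
  ext v
  obtain ⟨K, hK⟩ := exists_forall_ge_apply_sub_eq_zero hb q v
  rw [mul_expandZW_apply hb 0 p q v (K + 1) fun k hk => hK k (by lia), Finset.sum_range_succ']
  simp [Ring.choose_zero_succ, prodZW]

theorem mul_expandZW_apply_eq_zero (hb : b.LowerTruncated) (n p q : ℤ) (v : V)
    (h : ∀ m ≤ q, b m v = 0) : mul (expandZW F n) (prodZW a b) p q v = 0 := by
  rw [mul_expandZW_apply hb n p q v 0 fun k _ => h _ (by lia), Finset.sum_range_zero]

theorem mul_expandZW_apply_leading (hb : b.LowerTruncated) (n p q : ℤ) (v : V)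
    (h : ∀ m < q, b m v = 0) :
    mul (expandZW F n) (prodZW a b) p q v = a (p - n) (b q v) := by
  rw [mul_expandZW_apply hb n p q v 1 fun k _ => h _ (by lia)]
  simp

/-- On `p + q = n` the signs `(-1)^q` and `(-1)^p` differ by `(-1)^n`. Results on the second product
therefore reduce to the first by exchanging `z` and `w`. -/
theorem expandWZ_eq (n p q : ℤ) : expandWZ F n p q = (-1) ^ n * expandZW F n q p := by
  simp only [expandWZ, expandZW, add_comm q p]
  split_ifs with h
  · rw [← h.1, zpow_add₀ (by simp), ← mul_assoc, mul_right_comm _ _ ((-1 : F) ^ p),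
      ← mul_zpow]
    simp
  · simp

theorem prodWZ_eq (p q : ℤ) : prodWZ b a p q = prodZW b a q p := rfl

theorem expandWZ_smul_prodWZ (n p q : ℤ) (e : ℤ × ℤ) :
    expandWZ F n e.1 e.2 • prodWZ b a (p - e.1) (q - e.2) =
      (-1 : F) ^ n • (expandZW F n e.swap.1 e.swap.2 •
        prodZW b a (q - e.swap.1) (p - e.swap.2)) := by
  rw [smul_smul, expandWZ_eq]
  rfl

theorem mulDefined_expandWZ (ha : a.LowerTruncated) (n : ℤ) :
    MulDefined (expandWZ F n) (prodWZ b a) := by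
  intro p q v
  refine ((mulDefined_expandZW (a := b) ha n q p v).preimage
    Prod.swap_injective.injOn).subset fun e he => ?_
  simp only [expandWZ_smul_prodWZ] at he
  intro h
  exact he ((congrArg ((-1 : F) ^ n • ·) h).trans (smul_zero _))

theorem mul_expandWZ (ha : a.LowerTruncated) (n p q : ℤ) :
    mul (expandWZ F n) (prodWZ b a) p q =
      (-1 : F) ^ n • mul (expandZW F n) (prodZW b a) q p := by
  ext v
  rw [mul, mul, LinearMap.smul_apply, locallyFiniteSum_apply (mulDefined_expandWZ ha n p q),
    locallyFiniteSum_apply (mulDefined_expandZW ha n q p), smul_finsum,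
    ← finsum_comp_equiv (Equiv.prodComm ℤ ℤ)]
  refine finsum_congr fun e => ?_
  rw [expandWZ_smul_prodWZ]
  rfl

theorem mulZSubW_mul_expandWZ (ha : a.LowerTruncated) (n : ℤ) :
    mulZSubW (mul (expandWZ F n) (prodWZ b a)) = mul (expandWZ F (n + 1)) (prodWZ b a) := by
  funext p q
  rw [mulZSubW_apply, mul_expandWZ ha, mul_expandWZ ha, mul_expandWZ ha, ← smul_sub,
    ← mulZSubW_mul_expandZW ha, mulZSubW_apply, zpow_add₀ (by simp), zpow_one, mul_neg_one,
    neg_smul, ← smul_neg, neg_sub]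

theorem mul_expandWZ_zero (ha : a.LowerTruncated) :
    mul (expandWZ F 0) (prodWZ b a) = prodWZ b a := by
  funext p q
  rw [mul_expandWZ ha, mul_expandZW_zero ha, zpow_zero, one_smul, prodWZ_eq]

end Operators

end FormalDist₂

/-! ### Transport along `n`, and the derivation `∂_z + ∂_w` -/

namespace FormalDist₂

section AddCommGroup

variable {U U' : Type*} [AddCommGroup U] [AddCommGroup U']

theorem mulZSubW_iterate_map (φ : U →+ U') (N : ℕ) (A : FormalDist₂ U) :
    mulZSubW^[N] (fun p q => φ (A p q)) = fun p q => φ (mulZSubW^[N] A p q) := by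
  induction N generalizing A with
  | zero => rfl
  | succ N ih =>
    rw [Function.iterate_succ_apply, Function.iterate_succ_apply, ← ih]
    congr 1
    funext p q
    simp [mulZSubW]

theorem eq_zero_of_mulZSubW_iterate_eq_zero_of_bounded {A : FormalDist₂ U} {N : ℕ}
    (hA : mulZSubW^[N] A = 0) {q₀ : ℤ} (hbd : ∀ p, ∀ q < q₀, A p q = 0) : A = 0 := by
  induction N generalizing A with
  | zero => exact hA
  | succ N ih =>
    refine eq_zero_of_mulZSubW_eq_zero_of_bounded (ih hA fun p q hq => ?_) ⟨q₀, hbd⟩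
    rw [mulZSubW_apply, hbd _ _ hq, hbd _ _ (by lia), sub_zero]

/-- A sequence of distributions, bounded below in `w`, linked by multiplication by `z - w` and
starting with `0`, vanishes. -/
theorem eq_zero_of_mulZSubW_eq_succ {X : ℤ → FormalDist₂ U} (h0 : X 0 = 0)
    (hX : ∀ n, mulZSubW (X n) = X (n + 1))
    (hbd : ∀ n, ∃ q₀, ∀ p, ∀ q < q₀, X n p q = 0) (n : ℤ) : X n = 0 := by
  induction n using Int.induction_on with
  | zero => exact h0
  | succ i ih => rw [← hX, ih, ← Function.iterate_one mulZSubW, mulZSubW_iterate_zero]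
  | pred i ih =>
    exact eq_zero_of_mulZSubW_eq_zero_of_bounded
      (by rw [hX, sub_add_cancel, ih]) (hbd _)

/-- The derivative `(∂_z + ∂_w) A(z, w)`. -/
def derivAdd (A : FormalDist₂ U) : FormalDist₂ U :=
  fun p q => (p + 1) • A (p + 1) q + (q + 1) • A p (q + 1)

/-- Holds because `∂_z + ∂_w` kills `z - w`. -/
theorem mulZSubW_derivAdd (A : FormalDist₂ U) :
    mulZSubW (derivAdd A) = derivAdd (mulZSubW A) := by
  funext p q
  simp only [mulZSubW, derivAdd, sub_add_cancel, add_sub_cancel_right, smul_sub, add_smul,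
    one_smul]
  abel

theorem mulZSubW_sub (A B : FormalDist₂ U) : mulZSubW (A - B) = mulZSubW A - mulZSubW B := by
  funext p q
  simp only [mulZSubW, Pi.sub_apply]
  abel

theorem mulZSubW_iterate_sub (N : ℕ) (A B : FormalDist₂ U) :
    mulZSubW^[N] (A - B) = mulZSubW^[N] A - mulZSubW^[N] B := by
  induction N generalizing A B with
  | zero => rfl
  | succ N ih => simp only [Function.iterate_succ_apply, mulZSubW_sub, ih]

theorem mulZSubW_zsmul (k : ℤ) (A : FormalDist₂ U) : mulZSubW (k • A) = k • mulZSubW A := by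
  funext p q
  simp only [mulZSubW, Pi.smul_apply, smul_sub]

end AddCommGroup

section Translation

variable {F V : Type*} [Field F] [AddCommGroup V] [Module F V]
  {a b : FormalDist (Module.End F V)}

theorem _root_.FormalDist.LowerTruncated.deriv (ha : a.LowerTruncated) :
    a.deriv.LowerTruncated := by
  intro v
  obtain ⟨m₀, hm₀⟩ := ha v
  refine ⟨m₀ - 1, fun m hm => ?_⟩
  simp [FormalDist.deriv, hm₀ (m + 1) (by lia)]

theorem exists_mul_expandZW_apply_eq_zero (hb : b.LowerTruncated) (n : ℤ) (v : V) :
    ∃ q₀ : ℤ, ∀ p, ∀ q < q₀, mul (expandZW F n) (prodZW a b) p q v = 0 := by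
  obtain ⟨m₀, hm₀⟩ := hb v
  exact ⟨m₀, fun p q hq => mul_expandZW_apply_eq_zero hb n p q v fun m hm => hm₀ m (by lia)⟩

/-- At `n = 0` this is the Leibniz rule. The defect is bounded below in `w` on each vector and is
carried from `n` to `n + 1` by `z - w`, so it vanishes for all `n`. -/
theorem derivAdd_mul_expandZW (hb : b.LowerTruncated) (n : ℤ) :
    derivAdd (mul (expandZW F n) (prodZW a b)) =
      mul (expandZW F n) (prodZW a.deriv b) + mul (expandZW F n) (prodZW a b.deriv) := by
  rw [← sub_eq_zero, ← sub_sub]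
  funext p q
  ext v
  refine congrFun (congrFun (eq_zero_of_mulZSubW_eq_succ
    (X := fun n p q => (derivAdd (mul (expandZW F n) (prodZW a b)) -
      mul (expandZW F n) (prodZW a.deriv b) - mul (expandZW F n) (prodZW a b.deriv)) p q v)
    ?_ ?_ ?_ n) p) q
  · funext p q
    simp [mul_expandZW_zero hb, mul_expandZW_zero hb.deriv, derivAdd, prodZW, FormalDist.deriv]
  · intro n
    funext p q
    have h := mulZSubW_derivAdd (mul (expandZW F n) (prodZW a b))
    have h1 := mulZSubW_mul_expandZW (a := a.deriv) hb n
    have h2 := mulZSubW_mul_expandZW (a := a) hb.deriv n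
    rw [mulZSubW_mul_expandZW hb n] at h
    rw [← h, ← h1, ← h2, ← mulZSubW_sub, ← mulZSubW_sub]
    rfl
  · intro n
    obtain ⟨q₁, h₁⟩ := exists_mul_expandZW_apply_eq_zero (a := a) hb n v
    obtain ⟨q₂, h₂⟩ := exists_mul_expandZW_apply_eq_zero (a := a.deriv) hb n v
    obtain ⟨q₃, h₃⟩ := exists_mul_expandZW_apply_eq_zero (a := a) hb.deriv n v
    refine ⟨min (q₁ - 1) (min q₂ q₃), fun p q hq => ?_⟩
    simp only [lt_min_iff] at hq
    simp [derivAdd, h₁ _ q (by lia), h₁ _ (q + 1) (by lia), h₂ _ q (by lia), h₃ _ q (by lia)]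

theorem derivAdd_mul_expandWZ (ha : a.LowerTruncated) (n : ℤ) :
    derivAdd (mul (expandWZ F n) (prodWZ b a)) =
      mul (expandWZ F n) (prodWZ b a.deriv) + mul (expandWZ F n) (prodWZ b.deriv a) := by
  funext p q
  have h := congrFun (congrFun (derivAdd_mul_expandZW (a := b) ha n) q) p
  simp only [derivAdd, Pi.add_apply, mul_expandWZ ha, mul_expandWZ ha.deriv] at h ⊢
  rw [← smul_add, add_comm (mul _ (prodZW b a.deriv) _ _), ← h, smul_add,
    smul_comm (p + 1), smul_comm (q + 1), add_comm]

end Translation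

end FormalDist₂

/-! ### Dong's lemma -/

namespace FormalDist₃

variable (F : Type*) {U : Type*} [Field F] [AddCommGroup U] [Module F U]

/-- Multiplication of a distribution in `z`, `w`, `x` by `z - w`. -/
def mulZSubW : Module.End F (ℤ → ℤ → ℤ → U) where
  toFun G := fun p q r => G (p - 1) q r - G p (q - 1) r
  map_add' G H := by funext p q r; simp only [Pi.add_apply]; abel
  map_smul' c G := by funext p q r; simp [smul_sub]

/-- Multiplication of a distribution in `z`, `w`, `x` by `z - x`. -/
def mulZSubX : Module.End F (ℤ → ℤ → ℤ → U) where
  toFun G := fun p q r => G (p - 1) q r - G p q (r - 1)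
  map_add' G H := by funext p q r; simp only [Pi.add_apply]; abel
  map_smul' c G := by funext p q r; simp [smul_sub]

/-- Multiplication of a distribution in `z`, `w`, `x` by `w - x`. -/
def mulWSubX : Module.End F (ℤ → ℤ → ℤ → U) where
  toFun G := fun p q r => G p (q - 1) r - G p q (r - 1)
  map_add' G H := by funext p q r; simp only [Pi.add_apply]; abel
  map_smul' c G := by funext p q r; simp [smul_sub]

/-- Exchange of the variables `z` and `w`. -/
def swapZW : Module.End F (ℤ → ℤ → ℤ → U) where
  toFun G := fun p q r => G q p r
  map_add' _ _ := rfl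
  map_smul' _ _ := rfl

theorem mulZSubW_apply (G : ℤ → ℤ → ℤ → U) (p q r : ℤ) :
    mulZSubW F G p q r = G (p - 1) q r - G p (q - 1) r := rfl

theorem mulZSubX_apply (G : ℤ → ℤ → ℤ → U) (p q r : ℤ) :
    mulZSubX F G p q r = G (p - 1) q r - G p q (r - 1) := rfl

theorem mulWSubX_apply (G : ℤ → ℤ → ℤ → U) (p q r : ℤ) :
    mulWSubX F G p q r = G p (q - 1) r - G p q (r - 1) := rfl

/-- The pivot of Dong's lemma: vanishing under powers of `z - x` and `z - w` yields vanishing under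
a power of `w - x`. -/
theorem mulWSubX_eq_sub : mulWSubX F (U := U) = mulZSubX F - mulZSubW F := by
  refine LinearMap.ext fun G => ?_
  funext p q r
  simp only [LinearMap.sub_apply, Pi.sub_apply, mulZSubW_apply, mulZSubX_apply, mulWSubX_apply]
  abel

theorem commute_mulZSubX_mulZSubW : Commute (mulZSubX F (U := U)) (mulZSubW F) := by
  refine LinearMap.ext fun G => ?_
  funext p q r
  simp only [Module.End.mul_apply, mulZSubW_apply, mulZSubX_apply]
  abel

theorem commute_mulWSubX_mulZSubW : Commute (mulWSubX F (U := U)) (mulZSubW F) := by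
  rw [mulWSubX_eq_sub]
  exact (commute_mulZSubX_mulZSubW F).sub_left (Commute.refl _)

theorem commute_mulZSubX_mulWSubX : Commute (mulZSubX F (U := U)) (mulWSubX F) := by
  rw [mulWSubX_eq_sub]
  exact (Commute.refl _).sub_right (commute_mulZSubX_mulZSubW F)

theorem mulZSubX_mul_swapZW : mulZSubX F (U := U) * swapZW F = swapZW F * mulWSubX F := rfl

theorem mulWSubX_mul_swapZW : mulWSubX F (U := U) * swapZW F = swapZW F * mulZSubX F := rfl

theorem mulZSubX_pow_apply (N : ℕ) (G : ℤ → ℤ → ℤ → U) (q : ℤ) :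
    (fun p r => (mulZSubX F ^ N) G p q r) = FormalDist₂.mulZSubW^[N] fun p r => G p q r := by
  induction N generalizing G with
  | zero => rfl
  | succ N ih => rw [pow_succ, Module.End.mul_apply, ih]; rfl

theorem mulWSubX_pow_apply (N : ℕ) (G : ℤ → ℤ → ℤ → U) (p : ℤ) :
    (mulWSubX F ^ N) G p = FormalDist₂.mulZSubW^[N] (G p) := by
  induction N generalizing G with
  | zero => rfl
  | succ N ih => rw [pow_succ, Module.End.mul_apply, ih]; rfl

end FormalDist₃

/-- In the binomial expansion every term contains `f ^ m` or `g ^ n`; the induction peels off one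
factor `f - g` at a time. -/
theorem Module.End.sub_pow_apply_eq_zero {R M : Type*} [CommRing R] [AddCommGroup M] [Module R M]
    {f g : Module.End R M} (hfg : Commute f g) {m n : ℕ} {x : M}
    (hf : (f ^ m) x = 0) (hg : (g ^ n) x = 0) : ((f - g) ^ (m + n)) x = 0 := by
  induction m generalizing x n with
  | zero => rw [show x = 0 from hf, map_zero]
  | succ m ihm =>
    induction n generalizing x with
    | zero => rw [show x = 0 from hg, map_zero]
    | succ n ihn =>
      have h1 : ((f - g) ^ (m + (n + 1))) (f x) = 0 := by
        refine ihm (by rwa [← Module.End.mul_apply, ← pow_succ]) ?_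
        rw [← Module.End.mul_apply, ← (hfg.pow_right _).eq, Module.End.mul_apply, hg, map_zero]
      have h2 : ((f - g) ^ (m + 1 + n)) (g x) = 0 := by
        refine ihn ?_ (by rwa [← Module.End.mul_apply, ← pow_succ])
        rw [← Module.End.mul_apply, (hfg.pow_left _).eq, Module.End.mul_apply, hf, map_zero]
      rw [show m + 1 + (n + 1) = m + (n + 1) + 1 by ring, pow_succ, Module.End.mul_apply,
        LinearMap.sub_apply, map_sub, h1, show m + (n + 1) = m + 1 + n by ring, h2, sub_zero]

/-! ### Commutators of an expanded product with a third field -/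

namespace FormalDist₃

variable {F V : Type*} [Field F] [AddCommGroup V] [Module F V]
  {a b c : FormalDist (Module.End F V)}

/-- The twisted commutator `A(z, w) c(x) - s c(x) A(z, w)`. -/
def commutator {R : Type*} [Ring R] (A : FormalDist₂ R) (c : FormalDist R) (s : ℤ) :
    ℤ → ℤ → ℤ → R :=
  fun p q r => A p q * c r - s • (c r * A p q)

theorem mulZSubW_commutator (A : FormalDist₂ (Module.End F V)) (s : ℤ) :
    mulZSubW F (commutator A c s) = commutator (FormalDist₂.mulZSubW A) c s := by
  funext p q r
  simp only [mulZSubW_apply, commutator, FormalDist₂.mulZSubW, sub_mul, mul_sub, smul_sub]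
  abel

/-- For fixed powers of `x`, the powers of `w` occurring in `G(z, w, x) v` are bounded below. -/
def BoundedInW (G : ℤ → ℤ → ℤ → Module.End F V) : Prop :=
  ∀ r v, ∃ q₀ : ℤ, ∀ p, ∀ q < q₀, G p q r v = 0

theorem BoundedInW.mulZSubX_pow {G : ℤ → ℤ → ℤ → Module.End F V} (hG : BoundedInW G) (N : ℕ) :
    BoundedInW ((mulZSubX F ^ N) G) := by
  induction N with
  | zero => exact hG
  | succ N ih =>
    intro r v
    obtain ⟨q₁, h₁⟩ := ih r v
    obtain ⟨q₂, h₂⟩ := ih (r - 1) v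
    refine ⟨min q₁ q₂, fun p q hq => ?_⟩
    rw [lt_min_iff] at hq
    rw [pow_succ', Module.End.mul_apply, mulZSubX_apply, LinearMap.sub_apply, h₁ _ _ hq.1,
      h₂ _ _ hq.2, sub_zero]

theorem BoundedInW.mulWSubX_pow {G : ℤ → ℤ → ℤ → Module.End F V} (hG : BoundedInW G) (N : ℕ) :
    BoundedInW ((mulWSubX F ^ N) G) := by
  induction N with
  | zero => exact hG
  | succ N ih =>
    intro r v
    obtain ⟨q₁, h₁⟩ := ih r v
    obtain ⟨q₂, h₂⟩ := ih (r - 1) v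
    refine ⟨min q₁ q₂, fun p q hq => ?_⟩
    rw [lt_min_iff] at hq
    rw [pow_succ', Module.End.mul_apply, mulWSubX_apply, LinearMap.sub_apply, h₁ _ _ (by lia),
      h₂ _ _ hq.2, sub_zero]

theorem boundedInW_commutator_expandZW (hb : b.LowerTruncated) (n s : ℤ) :
    BoundedInW (commutator (FormalDist₂.mul (FormalDist₂.expandZW F n)
      (FormalDist₂.prodZW a b)) c s) := by
  intro r v
  obtain ⟨q₁, h₁⟩ := FormalDist₂.exists_mul_expandZW_apply_eq_zero (a := a) hb n v
  obtain ⟨q₂, h₂⟩ := FormalDist₂.exists_mul_expandZW_apply_eq_zero (a := a) hb n (c r v)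
  refine ⟨min q₁ q₂, fun p q hq => ?_⟩
  rw [lt_min_iff] at hq
  simp [commutator, h₁ _ _ hq.1, h₂ _ _ hq.2]

/-- The twisted commutator of `ab` with `c` is `a[b,c] + t[a,c]b`; `(w-x)^N` kills the first term
and `(z-x)^M` the second. -/
theorem mul_pow_commutator_prodZW_eq_zero {s t : ℤ} {M N : ℕ}
    (hac : FormalDist₂.mulZSubW^[M]
      (FormalDist₂.prodZW a c - s • FormalDist₂.prodWZ c a) = 0)
    (hbc : FormalDist₂.mulZSubW^[N]
      (FormalDist₂.prodZW b c - t • FormalDist₂.prodWZ c b) = 0) :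
    (mulZSubX F ^ M * mulWSubX F ^ N : Module.End F (ℤ → ℤ → ℤ → Module.End F V))
      (commutator (FormalDist₂.prodZW a b) c (s * t)) = 0 := by
  let G₁ : ℤ → ℤ → ℤ → Module.End F V := fun p q r => a p * (b q * c r - t • (c r * b q))
  let G₂ : ℤ → ℤ → ℤ → Module.End F V := fun p q r => t • ((a p * c r - s • (c r * a p)) * b q)
  have hG : commutator (FormalDist₂.prodZW a b) c (s * t) = G₁ + G₂ := by
    funext p q r
    simp only [commutator, FormalDist₂.prodZW, G₁, G₂, Pi.add_apply, mul_sub, sub_mul, smul_sub,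
      mul_smul_comm, smul_mul_assoc, mul_assoc, mul_comm s t, mul_smul]
    abel
  have h1 : (mulWSubX F ^ N) G₁ = 0 := by
    funext p q r
    rw [mulWSubX_pow_apply]
    refine (congrFun (congrFun (FormalDist₂.mulZSubW_iterate_map (AddMonoidHom.mulLeft (a p)) N
      (FormalDist₂.prodZW b c - t • FormalDist₂.prodWZ c b)) q) r).trans ?_
    rw [hbc]
    exact mul_zero _
  have h2 : (mulZSubX F ^ M) G₂ = 0 := by
    funext p q r
    refine (congrFun (congrFun (mulZSubX_pow_apply F M G₂ q) p) r).trans ?_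
    refine (congrFun (congrFun (FormalDist₂.mulZSubW_iterate_map
      (t • AddMonoidHom.mulRight (b q)) M
      (FormalDist₂.prodZW a c - s • FormalDist₂.prodWZ c a)) p) r).trans ?_
    rw [hac]
    exact map_zero _
  rw [hG, map_add, Module.End.mul_apply, h1, map_zero, zero_add,
    ((commute_mulZSubX_mulWSubX F).pow_pow M N).eq, Module.End.mul_apply, h2, map_zero]

/-- Multiplication by `z - w` commutes with both `z - x` and `w - x`, so the case `n = 0` spreads to
all `n`; boundedness in `w` makes the descent to negative `n` possible. -/
theorem mul_pow_commutator_expandZW_eq_zero (hb : b.LowerTruncated) {s t : ℤ} {M N : ℕ}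
    (hac : FormalDist₂.mulZSubW^[M]
      (FormalDist₂.prodZW a c - s • FormalDist₂.prodWZ c a) = 0)
    (hbc : FormalDist₂.mulZSubW^[N]
      (FormalDist₂.prodZW b c - t • FormalDist₂.prodWZ c b) = 0) (n : ℤ) :
    (mulZSubX F ^ M * mulWSubX F ^ N : Module.End F (ℤ → ℤ → ℤ → Module.End F V))
      (commutator (FormalDist₂.mul (FormalDist₂.expandZW F n)
      (FormalDist₂.prodZW a b)) c (s * t)) = 0 := by
  funext p q r
  ext v
  refine congrFun (congrFun (FormalDist₂.eq_zero_of_mulZSubW_eq_succ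
    (X := fun n p q =>
      (mulZSubX F ^ M * mulWSubX F ^ N : Module.End F (ℤ → ℤ → ℤ → Module.End F V))
      (commutator (FormalDist₂.mul (FormalDist₂.expandZW F n)
        (FormalDist₂.prodZW a b)) c (s * t)) p q r v) ?_ ?_ ?_ n) p) q
  · rw [FormalDist₂.mul_expandZW_zero hb, mul_pow_commutator_prodZW_eq_zero hac hbc]
    rfl
  · intro n
    rw [← FormalDist₂.mulZSubW_mul_expandZW hb, ← mulZSubW_commutator, ← Module.End.mul_apply,
      (((commute_mulZSubX_mulZSubW F).pow_left M).mul_left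
        ((commute_mulWSubX_mulZSubW F).pow_left N)).eq]
    rfl
  · exact fun n => ((boundedInW_commutator_expandZW hb n _).mulWSubX_pow N).mulZSubX_pow M r v

theorem mul_pow_commutator_expandWZ_eq_zero (ha : a.LowerTruncated) {s t : ℤ} {M N : ℕ}
    (hac : FormalDist₂.mulZSubW^[M]
      (FormalDist₂.prodZW a c - s • FormalDist₂.prodWZ c a) = 0)
    (hbc : FormalDist₂.mulZSubW^[N]
      (FormalDist₂.prodZW b c - t • FormalDist₂.prodWZ c b) = 0) (n : ℤ) :
    (mulZSubX F ^ M * mulWSubX F ^ N : Module.End F (ℤ → ℤ → ℤ → Module.End F V))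
      (commutator (FormalDist₂.mul (FormalDist₂.expandWZ F n)
      (FormalDist₂.prodWZ b a)) c (s * t)) = 0 := by
  have h : commutator (FormalDist₂.mul (FormalDist₂.expandWZ F n) (FormalDist₂.prodWZ b a)) c
      (s * t) = swapZW F ((-1 : F) ^ n • commutator (FormalDist₂.mul (FormalDist₂.expandZW F n)
      (FormalDist₂.prodZW b a)) c (t * s)) := by
    funext p q r
    change _ = (-1 : F) ^ n • commutator _ c (t * s) q p r
    simp only [commutator, FormalDist₂.mul_expandWZ ha, mul_comm t s, smul_sub, smul_mul_assoc,
      mul_smul_comm]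
    rw [smul_comm (s * t)]
  have hX : SemiconjBy (swapZW F (U := Module.End F V)) (mulZSubX F) (mulWSubX F) :=
    (mulWSubX_mul_swapZW F).symm
  have hW : SemiconjBy (swapZW F (U := Module.End F V)) (mulWSubX F) (mulZSubX F) :=
    (mulZSubX_mul_swapZW F).symm
  rw [h, ((commute_mulZSubX_mulWSubX F).pow_pow M N).eq, ← Module.End.mul_apply,
    ← ((hX.pow_right N).mul_right (hW.pow_right M)).eq, Module.End.mul_apply, map_smul,
    mul_pow_commutator_expandZW_eq_zero ha hbc hac, smul_zero, map_zero]

end FormalDist₃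

/-! ### The left side: Dong's lemma and Goddard uniqueness -/

namespace FormalDist₂

variable {F V : Type*} [Field F] [AddCommGroup V] [Module F V]
  {a b c d : FormalDist (Module.End F V)}

/-- The left side `a(z)b(w) i_{z,w}(z-w)^n - s b(w)a(z) i_{w,z}(z-w)^n` of the Borcherds
identity. -/
noncomputable def borcherdsLHS (a b : FormalDist (Module.End F V)) (s n : ℤ) :
    FormalDist₂ (Module.End F V) :=
  mul (expandZW F n) (prodZW a b) - s • mul (expandWZ F n) (prodWZ b a)

theorem mulZSubW_borcherdsLHS (ha : a.LowerTruncated) (hb : b.LowerTruncated) (s n : ℤ) :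
    mulZSubW (borcherdsLHS a b s n) = borcherdsLHS a b s (n + 1) := by
  rw [borcherdsLHS, mulZSubW_sub, mulZSubW_zsmul, mulZSubW_mul_expandZW hb,
    mulZSubW_mul_expandWZ ha, borcherdsLHS]

theorem mulZSubW_iterate_borcherdsLHS (ha : a.LowerTruncated) (hb : b.LowerTruncated) (s n : ℤ)
    (k : ℕ) : mulZSubW^[k] (borcherdsLHS a b s n) = borcherdsLHS a b s (n + k) := by
  induction k with
  | zero => simp
  | succ k ih =>
    rw [Function.iterate_succ_apply', ih, mulZSubW_borcherdsLHS ha hb]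
    push_cast
    rw [add_assoc]

theorem borcherdsLHS_eq_zero (ha : a.LowerTruncated) (hb : b.LowerTruncated) {s : ℤ} {N : ℕ}
    (hab : mulZSubW^[N] (prodZW a b - s • prodWZ b a) = 0) {n : ℤ} (hn : N ≤ n) :
    borcherdsLHS a b s n = 0 := by
  have h := mulZSubW_iterate_borcherdsLHS ha hb s 0 n.toNat
  rw [borcherdsLHS, mul_expandZW_zero hb, mul_expandWZ_zero ha,
    show n.toNat = (n.toNat - N) + N by lia, Function.iterate_add_apply, hab,
    mulZSubW_iterate_zero] at h
  rw [h]
  congr 1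
  lia

/-- **Dong's lemma**: the residue of `A(z, w)`, where `A` is the left side of the Borcherds identity
for local fields `a` and `b`, is local with every field local with both `a` and `b`. -/
theorem exists_mulZSubW_iterate_residue_eq_zero (ha : a.LowerTruncated) (hb : b.LowerTruncated)
    {u s t : ℤ} {L M N : ℕ}
    (hab : mulZSubW^[L] (prodZW a b - u • prodWZ b a) = 0)
    (hac : mulZSubW^[M] (prodZW a c - s • prodWZ c a) = 0)
    (hbc : mulZSubW^[N] (prodZW b c - t • prodWZ c b) = 0) (n : ℤ) :
    ∃ K : ℕ, mulZSubW^[K] (prodZW (borcherdsLHS a b u n (-1)) c -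
      (s * t) • prodWZ c (borcherdsLHS a b u n (-1))) = 0 := by
  set G := FormalDist₃.commutator (borcherdsLHS a b u n) c (s * t)
  have hG : G = FormalDist₃.commutator (mul (expandZW F n) (prodZW a b)) c (s * t) -
      u • FormalDist₃.commutator (mul (expandWZ F n) (prodWZ b a)) c (s * t) := by
    funext p q r
    simp only [G, FormalDist₃.commutator, borcherdsLHS, Pi.sub_apply, Pi.smul_apply, sub_mul,
      mul_sub, smul_sub, smul_mul_assoc, mul_smul_comm]
    rw [smul_comm (s * t) u]
    abel
  -- Multiplying by `(z-w)^k` pushes the exponent past the order of locality of `a` and `b`, where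
  -- the left side vanishes.
  obtain ⟨k, hk⟩ : ∃ k : ℕ, (L : ℤ) ≤ n + k := ⟨(L - n).toNat, by lia⟩
  have h1 : (FormalDist₃.mulZSubW F ^ k) G = 0 := by
    have : ∀ j : ℕ, (FormalDist₃.mulZSubW F ^ j) G =
        FormalDist₃.commutator (borcherdsLHS a b u (n + j)) c (s * t) := by
      intro j
      induction j with
      | zero => simp [G]
      | succ j ih =>
        rw [pow_succ', Module.End.mul_apply, ih, FormalDist₃.mulZSubW_commutator,
          mulZSubW_borcherdsLHS ha hb]
        push_cast
        rw [add_assoc]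
    rw [this, borcherdsLHS_eq_zero ha hb hab hk]
    funext p q r
    simp [FormalDist₃.commutator]
  have h2 : (FormalDist₃.mulZSubX F ^ M * FormalDist₃.mulWSubX F ^ N :
      Module.End F (ℤ → ℤ → ℤ → Module.End F V)) G = 0 := by
    rw [hG, map_sub, map_zsmul, FormalDist₃.mul_pow_commutator_expandZW_eq_zero hb hac hbc,
      FormalDist₃.mul_pow_commutator_expandWZ_eq_zero ha hac hbc, smul_zero, sub_zero]
  have h3 : (FormalDist₃.mulWSubX F ^ (M + k + N)) G = 0 := by
    rw [pow_add, Module.End.mul_apply]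
    -- Only the factor `(w-x)^(M+k)` is rewritten; the factor `(w-x)^N` stays on `G`, since
    -- `(z-x)^M` is known to kill only `(w-x)^N G`.
    conv_lhs => enter [1, 1]; rw [FormalDist₃.mulWSubX_eq_sub]
    refine Module.End.sub_pow_apply_eq_zero (FormalDist₃.commute_mulZSubX_mulZSubW F) h2 ?_
    rw [← Module.End.mul_apply, ← ((FormalDist₃.commute_mulWSubX_mulZSubW F).pow_pow N k).eq,
      Module.End.mul_apply, h1, map_zero]
  refine ⟨M + k + N, ?_⟩
  -- Multiplication by `w - x` leaves the power of `z` alone, so it passes to the coefficient of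
  -- `z^(-1)`.
  have h4 := FormalDist₃.mulWSubX_pow_apply F (M + k + N) G (-1)
  rw [h3] at h4
  exact h4.symm

/-- Goddard's uniqueness argument: a distribution that kills the vacuum vector `e` and is local
with a field creating `x` from `e` kills `x`. -/
theorem apply_eq_zero_of_local {s : ℤ} {K : ℕ} {e x : V}
    (hdc : mulZSubW^[K] (prodZW d c - s • prodWZ c d) = 0) (hd : ∀ q, d q e = 0)
    (hc : ∀ m < 0, c m e = 0) (hx : c 0 e = x) (q : ℤ) : d q x = 0 := by
  have h := mulZSubW_iterate_map (LinearMap.applyₗ e : Module.End F V →ₗ[F] V).toAddMonoidHom K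
    (prodZW d c - s • prodWZ c d)
  rw [hdc] at h
  -- As `d` kills `e`, locality applied to `e` leaves only `d(z)c(x)e`, which has no negative powers
  -- of `x`.
  have h' : (fun p r => d p (c r e)) = 0 := by
    refine eq_zero_of_mulZSubW_iterate_eq_zero_of_bounded (N := K) (q₀ := 0) ?_
      fun p r hr => by rw [hc r hr, map_zero]
    refine Eq.trans ?_ (h.trans ?_)
    · congr 1
      funext p r
      simp [prodZW, prodWZ, hd]
    · funext p q
      simp
  rw [← hx]
  exact congrFun (congrFun h' q) 0

theorem derivAdd_borcherdsLHS (ha : a.LowerTruncated) (hb : b.LowerTruncated) (s n : ℤ) :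
    derivAdd (borcherdsLHS a b s n) = borcherdsLHS a.deriv b s n + borcherdsLHS a b.deriv s n := by
  have h1 := derivAdd_mul_expandZW (a := a) hb n
  have h2 := derivAdd_mul_expandWZ (b := b) ha n
  have h3 : derivAdd (borcherdsLHS a b s n) = derivAdd (mul (expandZW F n) (prodZW a b)) -
      s • derivAdd (mul (expandWZ F n) (prodWZ b a)) := by
    funext p q
    simp only [derivAdd, borcherdsLHS, Pi.sub_apply, Pi.smul_apply, smul_sub, smul_add,
      smul_comm s]
    abel
  rw [h3, h1, h2, borcherdsLHS, borcherdsLHS, smul_add]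
  abel

end FormalDist₂

/-! ### Coefficients of `∂_w^j δ(z, w) / j!` -/

theorem Int.succ_mul_choose_succ (r : ℤ) (k : ℕ) :
    (k + 1) * Ring.choose r (k + 1) = (r - k) * Ring.choose r k := by
  have h := Ring.choose_add_smul_choose (r - k) 1 k
  rw [sub_add_cancel, Ring.choose_one_right, add_comm 1 k, Nat.choose_succ_self_right,
    nsmul_eq_mul] at h
  push_cast at h
  rw [h, mul_comm]

namespace FormalDist₂

theorem derivW_iterate_apply {U : Type*} [AddCommGroup U] (A : FormalDist₂ U) (j : ℕ) (p q : ℤ) :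
    derivW^[j] A p q = (j.factorial * Ring.choose (q + j) j : ℤ) • A p (q + j) := by
  induction j generalizing q with
  | zero => simp
  | succ j ih =>
    rw [Function.iterate_succ_apply', derivW, ih, smul_smul,
      show q + 1 + (j : ℤ) = q + ((j + 1 : ℕ) : ℤ) by push_cast; ring]
    congr 1
    have h := Int.succ_mul_choose_succ (q + ((j + 1 : ℕ) : ℤ)) j
    rw [Nat.factorial_succ]
    push_cast at h ⊢
    linear_combination (-(j.factorial : ℤ)) * h

section Delta

variable {F V : Type*} [Field F] [CharZero F] [AddCommGroup V] [Module F V]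
  {c : FormalDist (Module.End F V)}

theorem deltaDeriv_apply (j : ℕ) (p q : ℤ) :
    deltaDeriv F j p q = if q = -p - 1 - j then ((Ring.choose (-p - 1) j : ℤ) : F) else 0 := by
  simp only [deltaDeriv, Pi.smul_apply, derivW_iterate_apply, delta, smul_eq_mul]
  have hj : (j.factorial : F) ≠ 0 := Nat.cast_ne_zero.2 j.factorial_ne_zero
  by_cases h : q = -p - 1 - j
  · rw [if_pos h, if_pos (by lia), show q + j = -p - 1 by lia, zsmul_one]
    push_cast
    field_simp
  · rw [if_neg h, if_neg (by lia), smul_zero, mul_zero]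

theorem support_deltaDeriv_smul_inW_subset (j : ℕ) (p q : ℤ) (v : V) :
    (Function.support fun e : ℤ × ℤ =>
      (deltaDeriv F j e.1 e.2 • FormalDist.inW c (p - e.1) (q - e.2)) v) ⊆
      (({(p, -p - 1 - j)} : Finset (ℤ × ℤ)) : Set (ℤ × ℤ)) := by
  rintro ⟨e₁, e₂⟩ he
  simp only [Function.mem_support, FormalDist.inW, deltaDeriv_apply] at he
  simp only [Finset.coe_singleton, Set.mem_singleton_iff, Prod.mk.injEq]
  by_cases h1 : e₁ = p
  · subst h1
    refine ⟨rfl, ?_⟩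
    by_contra h2
    exact he (by rw [if_neg h2, zero_smul, LinearMap.zero_apply])
  · exact absurd (by rw [if_neg (sub_ne_zero.2 (Ne.symm h1)), smul_zero, LinearMap.zero_apply]) he

theorem mulDefined_deltaDeriv (j : ℕ) : MulDefined (deltaDeriv F j) (FormalDist.inW c) :=
  fun p q v => (Finset.finite_toSet _).subset (support_deltaDeriv_smul_inW_subset j p q v)

theorem mul_deltaDeriv_inW_apply (j : ℕ) (p q : ℤ) :
    mul (deltaDeriv F j) (FormalDist.inW c) p q = Ring.choose (-p - 1) j • c (p + q + 1 + j) := by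
  ext v
  rw [mul, locallyFiniteSum_apply (mulDefined_deltaDeriv j p q),
    finsum_eq_sum_of_support_subset _ (support_deltaDeriv_smul_inW_subset j p q v),
    Finset.sum_singleton, deltaDeriv_apply, if_pos rfl, FormalDist.inW, if_pos (sub_self p),
    Int.cast_smul_eq_zsmul, show q - (-p - 1 - (j : ℤ)) = p + q + 1 + j by ring]

end Delta

end FormalDist₂

theorem koszulSign_add_left (α β γ : ZMod 2) :
    koszulSign (α + β) γ = koszulSign α γ * koszulSign β γ := by
  revert α β γ
  decide

/-! ### Fields of a `z`-algebra -/

namespace ZAlgebra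

variable {F V : Type*} [Field F] [AddCommGroup V] [Module F V] (A : ZAlgebra F V)

theorem lowerTruncated_field (a : V) : (A.field a).LowerTruncated := fun v =>
  ⟨_, fun m hm => VertexOperator.coeff_eq_zero_of_lt_order (A.Y a) m v hm⟩

theorem nProd_eq (a : V) (n : ℤ) (b : V) : A.nProd a n b = A.field a (-n - 1) b := rfl

theorem field_zero : A.field 0 = 0 := by
  rw [field, map_zero, map_zero]

theorem field_T (a : V) : A.field (A.T a) = (A.field a).deriv := A.Y_T a

theorem field_add (a b : V) : A.field (a + b) = A.field a + A.field b := by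
  rw [field, map_add, map_add]
  rfl

theorem exists_nProd_eq_zero (a b : V) : ∃ n₀ : ℤ, ∀ n ≥ n₀, A.nProd a n b = 0 := by
  obtain ⟨m₀, hm₀⟩ := A.lowerTruncated_field a b
  exact ⟨-m₀, fun n hn => hm₀ _ (by lia)⟩

theorem exists_forall_ge_nProd_eq_zero (a b : V) (n : ℤ) :
    ∃ K : ℕ, ∀ j : ℕ, K ≤ j → A.nProd a (n + j) b = 0 := by
  obtain ⟨n₀, hn₀⟩ := A.exists_nProd_eq_zero a b
  exact ⟨(n₀ - n).toNat, fun j hj => hn₀ _ (by lia)⟩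

theorem finite_nProd_ne_zero (a b : V) (n : ℤ) : {j : ℕ | A.nProd a (n + j) b ≠ 0}.Finite := by
  obtain ⟨n₀, hn₀⟩ := A.exists_nProd_eq_zero a b
  refine (Set.finite_lt_nat (n₀ - n).toNat).subset fun j hj => ?_
  by_contra h
  exact hj (hn₀ _ (by simp only [Set.mem_ofPred_eq] at h; lia))

theorem eq_zero_of_homogeneous {f : Module.End F V} (hf : ∀ α, ∀ x ∈ A.parity α, f x = 0) :
    f = 0 := by
  have h : ⨆ α, A.parity α ≤ LinearMap.ker f := iSup_le fun α x hx => hf α x hx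
  rw [A.isInternal.submodule_iSup_eq_top, top_le_iff] at h
  exact LinearMap.ker_eq_top.1 h

end ZAlgebra

/-! ### The `n`-th product identity -/

namespace VertexAlgebra

open FormalDist₂

variable {F V : Type*} [Field F] [AddCommGroup V] [Module F V] (A : VertexAlgebra F V)

theorem field_apply_one_of_neg (a : V) {m : ℤ} (hm : m < 0) : A.field a m A.one = 0 := by
  rw [A.isUnitElement.2.2 a m hm.le, if_neg hm.ne]

theorem field_zero_apply_one (a : V) : A.field a 0 A.one = a := by
  rw [A.isUnitElement.2.2 a 0 le_rfl, if_pos rfl]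

theorem borcherdsLHS_residue_apply_one_of_neg (a b : V) (s n : ℤ) {q : ℤ} (hq : q < 0) :
    borcherdsLHS (A.field a) (A.field b) s n (-1) q A.one = 0 := by
  simp only [borcherdsLHS, Pi.sub_apply, Pi.smul_apply, LinearMap.sub_apply, LinearMap.smul_apply,
    mul_expandWZ (A.lowerTruncated_field a)]
  rw [mul_expandZW_apply_eq_zero (A.lowerTruncated_field b) _ _ _ _
      fun m hm => A.field_apply_one_of_neg b (by lia),
    mul_expandZW_apply_eq_zero (A.lowerTruncated_field a) _ _ _ _
      fun m hm => A.field_apply_one_of_neg a (by lia)]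
  simp

/-- In the first product only `k = 0` survives, giving `a_(n)` applied to `b`. The second involves
only `a_m 1` with `m < 0`, which are zero. -/
theorem borcherdsLHS_residue_zero_apply_one (a b : V) (s n : ℤ) :
    borcherdsLHS (A.field a) (A.field b) s n (-1) 0 A.one = A.nProd a n b := by
  simp only [borcherdsLHS, Pi.sub_apply, Pi.smul_apply, LinearMap.sub_apply, LinearMap.smul_apply,
    mul_expandWZ (A.lowerTruncated_field a)]
  rw [mul_expandZW_apply_leading (A.lowerTruncated_field b) _ _ _ _
      fun m hm => A.field_apply_one_of_neg b hm,
    mul_expandZW_apply_eq_zero (A.lowerTruncated_field a) _ _ _ _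
      fun m hm => A.field_apply_one_of_neg a (by lia), A.field_zero_apply_one, A.nProd_eq,
    neg_sub_comm]
  simp

/-- Induction on the power of `w`, with `a` and `b` free so that the hypothesis applies to `(Ta, b)`
and `(a, Tb)`. -/
theorem borcherdsLHS_residue_apply_one [CharZero F] (a b : V) (s n q : ℤ) :
    borcherdsLHS (A.field a) (A.field b) s n (-1) q A.one = A.field (A.nProd a n b) q A.one := by
  rcases lt_or_ge q 0 with hq | hq
  · rw [A.borcherdsLHS_residue_apply_one_of_neg a b s n hq, A.field_apply_one_of_neg _ hq]
  obtain ⟨k, rfl⟩ := Int.eq_ofNat_of_zero_le hq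
  clear hq
  induction k generalizing a b with
  | zero =>
    rw [Nat.cast_zero, A.borcherdsLHS_residue_zero_apply_one, A.field_zero_apply_one]
  | succ k ih =>
    -- At `z^(-1)` the `∂_z` part has factor `-1 + 1 = 0`, leaving `k + 1` times the coefficient of
    -- `w^(k+1)`; characteristic `0` allows division by `k + 1`.
    have h1 := congrFun (congrFun (derivAdd_borcherdsLHS (A.lowerTruncated_field a)
      (A.lowerTruncated_field b) s n) (-1)) k
    have h2 : A.T (A.nProd a n b) = A.nProd (A.T a) n b + A.nProd a n (A.T b) :=
      A.T_derivation a b _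
    have h3 := congrArg (fun x => A.field x k A.one) h2
    simp only [A.field_add, Pi.add_apply, LinearMap.add_apply, ← ih] at h3
    rw [A.field_T (A.nProd a n b)] at h3
    rw [← A.field_T, ← A.field_T] at h1
    have h4 := congrArg (fun f : Module.End F V => f A.one) h1
    simp only [derivAdd, Pi.add_apply, LinearMap.add_apply, neg_add_cancel, zero_smul,
      zero_add] at h4
    rw [← h3] at h4
    have h5 : ((k : F) + 1) ≠ 0 := by exact_mod_cast k.succ_ne_zero
    refine smul_right_injective V h5 ?_
    have h6 : ∀ x : V, ((k : F) + 1) • x = ((k : ℤ) + 1) • x := fun x => by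
      rw [← Int.cast_smul_eq_zsmul F]
      push_cast
      rfl
    simp only [h6]
    push_cast
    exact h4

/-- The `n`-th product identity `Res_z A(z, w) = (a_(n) b)(w)`. -/
theorem borcherdsLHS_residue [CharZero F] {α β : ZMod 2} {a b : V} (ha : a ∈ A.parity α)
    (hb : b ∈ A.parity β) (n q : ℤ) :
    borcherdsLHS (A.field a) (A.field b) (koszulSign α β) n (-1) q =
      A.field (A.nProd a n b) q := by
  rw [← sub_eq_zero]
  refine A.eq_zero_of_homogeneous fun γ x hx => ?_
  obtain ⟨L, hab⟩ := A.isLocal α β a b ha hb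
  obtain ⟨M, hac⟩ := A.isLocal α γ a x ha hx
  obtain ⟨N, hbc⟩ := A.isLocal β γ b x hb hx
  obtain ⟨K, hK⟩ := exists_mulZSubW_iterate_residue_eq_zero (A.lowerTruncated_field a)
    (A.lowerTruncated_field b) hab hac hbc n
  -- Dong's lemma yields the product of the two signs, which is the sign for parity `α + β` of
  -- `a_(n) b`; the two locality relations can then be subtracted.
  rw [← koszulSign_add_left] at hK
  obtain ⟨K', hK'⟩ := A.isLocal (α + β) γ (A.nProd a n b) x (A.Y_parity α β a b ha hb _) hx
  refine apply_eq_zero_of_local (c := A.field x) (s := koszulSign (α + β) γ) (K := K + K')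
    (d := borcherdsLHS (A.field a) (A.field b) (koszulSign α β) n (-1) - A.field (A.nProd a n b))
    (e := A.one) ?_ ?_ (fun m hm => A.field_apply_one_of_neg x hm) (A.field_zero_apply_one x) q
  · refine Eq.trans (b := mulZSubW^[K + K'] ((prodZW (borcherdsLHS (A.field a) (A.field b)
      (koszulSign α β) n (-1)) (A.field x) - koszulSign (α + β) γ • prodWZ (A.field x)
      (borcherdsLHS (A.field a) (A.field b) (koszulSign α β) n (-1))) -
      (prodZW (A.field (A.nProd a n b)) (A.field x) - koszulSign (α + β) γ • prodWZ (A.field x)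
      (A.field (A.nProd a n b))))) ?_ ?_
    · congr 1
      funext p r
      simp only [prodZW, prodWZ, Pi.sub_apply, Pi.smul_apply, sub_mul, mul_sub, smul_sub]
      abel
    · rw [mulZSubW_iterate_sub, Function.iterate_add_apply _ K K'
        (prodZW (A.field (A.nProd a n b)) _ - _), hK', mulZSubW_iterate_zero, add_comm K K',
        Function.iterate_add_apply, hK, mulZSubW_iterate_zero, sub_zero]
  · intro q
    rw [Pi.sub_apply, LinearMap.sub_apply, A.borcherdsLHS_residue_apply_one, sub_self]

end VertexAlgebra

/-- The right side `∑_j (a_(n+j) b)(w) ∂_w^j δ(z, w) / j!` of the Borcherds identity. -/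
noncomputable def ZAlgebra.borcherdsRHS {F V : Type*} [Field F] [AddCommGroup V] [Module F V]
    (A : ZAlgebra F V) (a b : V) (n : ℤ) : FormalDist₂ (Module.End F V) :=
  ∑ᶠ j : ℕ, FormalDist₂.mul (FormalDist₂.deltaDeriv F j)
    (FormalDist.inW (A.field (A.nProd a (n + j) b)))

/-! ### The right side of the identity -/

namespace ZAlgebra

open FormalDist₂

variable {F V : Type*} [Field F] [CharZero F] [AddCommGroup V] [Module F V] (A : ZAlgebra F V)

theorem borcherdsRHS_apply (a b : V) (n p q : ℤ) {K : ℕ}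
    (hK : ∀ j : ℕ, K ≤ j → A.nProd a (n + j) b = 0) :
    A.borcherdsRHS a b n p q = ∑ j ∈ Finset.range K,
      Ring.choose (-p - 1) j • A.field (A.nProd a (n + j) b) (p + q + 1 + j) := by
  rw [borcherdsRHS, finsum_eq_sum_of_support_subset (s := Finset.range K)]
  · simp only [Finset.sum_apply, mul_deltaDeriv_inW_apply]
  · intro j hj
    simp only [Finset.coe_range, Set.mem_Iio]
    by_contra h
    refine hj ?_
    funext p q
    refine (mul_deltaDeriv_inW_apply j p q).trans ?_
    rw [hK j (by lia), A.field_zero]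
    simp

/-- Pascal's rule again: the `j = 0` terms cancel, and term `j + 1` becomes term `j` for `n + 1`. -/
theorem mulZSubW_borcherdsRHS (a b : V) (n : ℤ) :
    mulZSubW (A.borcherdsRHS a b n) = A.borcherdsRHS a b (n + 1) := by
  obtain ⟨K, hK⟩ := A.exists_forall_ge_nProd_eq_zero a b (n + 1)
  have hK' : ∀ j : ℕ, K + 1 ≤ j → A.nProd a (n + j) b = 0 := by
    intro j hj
    have := hK (j - 1) (by lia)
    rwa [show n + 1 + ((j - 1 : ℕ) : ℤ) = n + j by lia] at this
  funext p q
  rw [mulZSubW_apply, A.borcherdsRHS_apply a b n _ _ hK', A.borcherdsRHS_apply a b n _ _ hK',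
    A.borcherdsRHS_apply a b (n + 1) _ _ hK, Finset.sum_range_succ', Finset.sum_range_succ',
    Ring.choose_zero_right, Ring.choose_zero_right,
    show p - 1 + q + 1 = p + (q - 1) + 1 by ring, add_sub_add_right_eq_sub,
    ← Finset.sum_sub_distrib]
  refine Finset.sum_congr rfl fun j _ => ?_
  rw [← sub_smul, show -(p - 1) - 1 = -p - 1 + 1 by ring, Ring.choose_succ_succ,
    add_sub_cancel_right, show n + ((j + 1 : ℕ) : ℤ) = n + 1 + j by push_cast; ring,
    show p + (q - 1) + 1 + ((j + 1 : ℕ) : ℤ) = p + q + 1 + j by push_cast; ring]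

/-- At `p = -1` the coefficient is the binomial of `0` over `j`, so only `j = 0` remains. -/
theorem borcherdsRHS_residue (a b : V) (n q : ℤ) :
    A.borcherdsRHS a b n (-1) q = A.field (A.nProd a n b) q := by
  obtain ⟨K, hK⟩ := A.exists_forall_ge_nProd_eq_zero a b n
  rw [A.borcherdsRHS_apply a b n _ _ (K := K + 1) fun j hj => hK j (by lia),
    Finset.sum_range_succ']
  simp [Ring.choose_zero_succ]

theorem borcherdsRHS_eq_zero {a b : V} {n : ℤ} (h : ∀ m ≥ n, A.nProd a m b = 0) :
    A.borcherdsRHS a b n = 0 := by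
  funext p q
  rw [A.borcherdsRHS_apply a b n p q (K := 0) fun j _ => h _ (by lia), Finset.sum_range_zero]
  rfl

end ZAlgebra

/-- Descending induction on `n` from the range where both sides vanish; `k` bounds the number of
steps down from it. -/
theorem VertexAlgebra.borcherdsLHS_eq_borcherdsRHS {F V : Type*} [Field F] [CharZero F]
    [AddCommGroup V] [Module F V] (A : VertexAlgebra F V) {α β : ZMod 2} {a b : V}
    (ha : a ∈ A.parity α) (hb : b ∈ A.parity β) (n : ℤ) :
    FormalDist₂.borcherdsLHS (A.field a) (A.field b) (koszulSign α β) n =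
      A.borcherdsRHS a b n := by
  obtain ⟨N, hab⟩ := A.isLocal α β a b ha hb
  obtain ⟨n₀, hn₀⟩ := A.exists_nProd_eq_zero a b
  have hla := A.lowerTruncated_field a
  have hlb := A.lowerTruncated_field b
  have key : ∀ (k : ℕ) (n : ℤ), max (N : ℤ) n₀ ≤ n + k →
      FormalDist₂.borcherdsLHS (A.field a) (A.field b) (koszulSign α β) n =
        A.borcherdsRHS a b n := by
    intro k
    induction k with
    | zero =>
      intro n hn
      rw [FormalDist₂.borcherdsLHS_eq_zero hla hlb hab (by lia),
        A.borcherdsRHS_eq_zero fun m hm => hn₀ m (by lia)]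
    | succ k ih =>
      intro n hn
      rw [← sub_eq_zero]
      refine FormalDist₂.eq_zero_of_mulZSubW_eq_zero_of_residue ?_ fun q => ?_
      · rw [FormalDist₂.mulZSubW_sub, FormalDist₂.mulZSubW_borcherdsLHS hla hlb,
          A.mulZSubW_borcherdsRHS, ih (n + 1) (by push_cast at hn; lia), sub_self]
      · rw [Pi.sub_apply, Pi.sub_apply, A.borcherdsLHS_residue ha hb, A.borcherdsRHS_residue,
          sub_self]
  exact key (max (N : ℤ) n₀ - n).toNat n (by lia)

/-- Borcherds identity. The first four conjuncts say that all the infinite sums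
and products which occur in the identity are well defined; the last one is the identity. -/
theorem proposition3p1 {F V : Type*} [Field F] [CharZero F] [AddCommGroup V] [Module F V]
    (A : VertexAlgebra F V) (n : ℤ) (α β : ZMod 2) (a b : V)
    (ha : a ∈ A.parity α) (hb : b ∈ A.parity β) :
    FormalDist₂.MulDefined (FormalDist₂.expandZW F n)
      (FormalDist₂.prodZW (A.field a) (A.field b)) ∧
    FormalDist₂.MulDefined (FormalDist₂.expandWZ F n)
      (FormalDist₂.prodWZ (A.field b) (A.field a)) ∧
    (∀ j : ℕ, FormalDist₂.MulDefined (FormalDist₂.deltaDeriv F j)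
      (FormalDist.inW (A.field (A.nProd a (n + j) b)))) ∧
    {j : ℕ | A.nProd a (n + j) b ≠ 0}.Finite ∧
    FormalDist₂.mul (FormalDist₂.expandZW F n)
        (FormalDist₂.prodZW (A.field a) (A.field b)) -
      koszulSign α β • FormalDist₂.mul (FormalDist₂.expandWZ F n)
        (FormalDist₂.prodWZ (A.field b) (A.field a)) =
    ∑ᶠ j : ℕ, FormalDist₂.mul (FormalDist₂.deltaDeriv F j)
      (FormalDist.inW (A.field (A.nProd a (n + j) b))) := by
  exact ⟨FormalDist₂.mulDefined_expandZW (A.lowerTruncated_field b) n,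
    FormalDist₂.mulDefined_expandWZ (A.lowerTruncated_field a) n,
    fun j => FormalDist₂.mulDefined_deltaDeriv j, A.finite_nProd_ne_zero a b n,
    A.borcherdsLHS_eq_borcherdsRHS ha hb n⟩
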